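/- Let $B^4=\{x\in\mathbb{R}^4:|x|<1\}$, and identify $x\in\mathbb{R}^4$ with the quaternion $x_1+x_2i+x_3j+x_4k$, so that $dx=dx^1+i\,dx^2+j\,dx^3+k\,dx^4$. For $p\in B^4$ let $h_p$ be the solution, continuous on $\overline{B^4}$, of the Dirichlet problem for one-forms on $B^4$ with values in the imaginary quaternions $$\Delta h_p=0\ \text{ in } B^4,\qquad h_p(x)=\operatorname{Im}\frac{(\overline{x}-\overline{p})\,dx}{|x-p|^4}\ \text{ for } x\in\partial B^4,$$ where $\Delta$ acts on the coefficients of the form and all components of the form (not only the tangential ones) are prescribed on $\partial B^4$. For a two-form $\omega$ on $\mathbb{R}^4$ put $\omega^-=\frac12(\omega-\ast\omega)$, where $\ast$ is the Hodge star of the flat metric and the standard orientation, and let $|\omega|$ be the Euclidean norm for which the $dx^i\wedge dx^j$ ($i<j$) are orthonormal and the values are measured by the quaternion norm. Put $$F(p)=\int_{B^4}|(dh_p)^-|^2\,dx,\qquad d(p)=1-|p|\qquad(p\in B^4).$$ Then the Dirichlet problem has exactly one solution on $\overline{B^4}$ for every $p\in B^4$, and: 1. $F(p)>0$ for all $p\in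 B^4$; 2. there is a constant $C_1>0$, independent of $p$, such that $F(p)=C_1\,d(p)^{-4}+o(d(p)^{-4})$ as $p\in B^4$ approaches $\partial B^4$; 3. $F$ is differentiable on $B^4$, and there is a constant $C_2>0$, independent of $p$, such that its gradient satisfies $F'(p)=C_2\,d(p)^{-5}\,\frac{p}{|p|}+o(d(p)^{-5})$ as $p\in B^4$ approaches $\partial B^4$. In 2 and 3, "as $p$ approaches $\partial B^4$" means as $|p|\to1^-$, uniformly in the direction of $p$. -/

import Mathlib

open Set Filter Topology MeasureTheory Metric InnerProductSpace
open scoped Quaternion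

namespace YMDirichlet

/-- Euclidean four-space. -/
abbrev E4 : Type := EuclideanSpace ℝ (Fin 4)

/-- The standard (positively oriented, orthonormal) basis of `E4`; the coordinates `x₁, …, x₄` are
indexed by `0, …, 3`. -/
noncomputable def e (i : Fin 4) : E4 := EuclideanSpace.single i 1

/-- The identification `x ↦ x₁ + x₂ i + x₃ j + x₄ k` of `E4` with the quaternions. -/
noncomputable def toQuat : E4 →L[ℝ] ℍ :=
  (Quaternion.linearIsometryEquivTuple.symm.toContinuousLinearEquiv : E4 →L[ℝ] ℍ)

theorem toQuat_apply (x : E4) : toQuat x = ⟨x 0, x 1, x 2, x 3⟩ := rfl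

/-- The imaginary part `a + b i + c j + d k ↦ b i + c j + d k`, as a continuous real linear map. -/
noncomputable def imPart : ℍ →L[ℝ] ℍ where
  toFun q := q.im
  map_add' a b := by ext <;> simp
  map_smul' c a := by ext <;> simp
  cont := Quaternion.continuous_im

/-- The one-form `Im ((x̄ - p̄) dx) / |x - p| ^ 4` with values in the imaginary quaternions, where
`dx = dx₁ + i dx₂ + j dx₃ + k dx₄`. Its value at the point `x` on a vector `v` is
`Im ((x̄ - p̄) v) / |x - p| ^ 4`. -/
noncomputable def boundaryForm (p x : E4) : E4 [⋀^Fin 1]→L[ℝ] ℍ :=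
  ContinuousAlternatingMap.ofSubsingleton ℝ E4 ℍ 0
    ((1 / ‖x - p‖ ^ 4) •
      imPart.comp ((ContinuousLinearMap.mul ℝ ℍ (star (toQuat (x - p)))).comp toQuat))

theorem boundaryForm_apply (p x : E4) (v : Fin 1 → E4) :
    boundaryForm p x v
      = (1 / ‖x - p‖ ^ 4) • (star (toQuat (x - p)) * toQuat (v 0)).im := rfl

/-- `u` is a solution of the Dirichlet problem `Δ u = 0` in `B⁴` with `u` equal, in all of its
components, to `Im ((x̄ - p̄) dx) / |x - p| ^ 4` on `∂B⁴`. The flat Laplacian acts on the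
coefficients of the form `u`, and `u` is continuous up to the boundary. -/
def IsDirichletSolution (p : E4) (u : E4 → E4 [⋀^Fin 1]→L[ℝ] ℍ) : Prop :=
  HarmonicContOnCl u (ball 0 1) ∧ EqOn u (boundaryForm p) (sphere 0 1)

open Classical in
/-- The form `h_p`: the solution of the Dirichlet problem (with value `0` where there is none). -/
noncomputable def hForm (p : E4) : E4 → E4 [⋀^Fin 1]→L[ℝ] ℍ :=
  if hp : ∃ u, IsDirichletSolution p u then hp.choose else 0

/-- The two-form `dx_k ∧ dx_l`. -/
noncomputable def dxdx (k l : Fin 4) : E4 [⋀^Fin 2]→L[ℝ] ℝ where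
  toFun v := v 0 k * v 1 l - v 0 l * v 1 k
  map_update_add' m i x y := by
    fin_cases i <;> simp [Function.update] <;> ring
  map_update_smul' m i c x := by
    fin_cases i <;> simp [Function.update] <;> ring
  cont := by fun_prop
  map_eq_zero_of_eq' v i j hv hij := by
    have h01 : v 0 = v 1 := by
      fin_cases i <;> fin_cases j <;> simp_all
    simp [h01, mul_comm]

theorem dxdx_apply (k l : Fin 4) (v : Fin 2 → E4) :
    dxdx k l v = v 0 k * v 1 l - v 0 l * v 1 k := rfl

/-- The Hodge star on two-forms on `E4` with respect to the flat metric and the standard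
orientation `dx₁ ∧ dx₂ ∧ dx₃ ∧ dx₄`, that is
`⋆(dx₁∧dx₂) = dx₃∧dx₄`, `⋆(dx₁∧dx₃) = -dx₂∧dx₄`, `⋆(dx₁∧dx₄) = dx₂∧dx₃`,
`⋆(dx₂∧dx₃) = dx₁∧dx₄`, `⋆(dx₂∧dx₄) = -dx₁∧dx₃`, `⋆(dx₃∧dx₄) = dx₁∧dx₂`. -/
noncomputable def hodgeStar (ω : E4 [⋀^Fin 2]→L[ℝ] ℍ) : E4 [⋀^Fin 2]→L[ℝ] ℍ :=
  (dxdx 2 3).smulRight (ω ![e 0, e 1]) - (dxdx 1 3).smulRight (ω ![e 0, e 2])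
    + (dxdx 1 2).smulRight (ω ![e 0, e 3]) + (dxdx 0 3).smulRight (ω ![e 1, e 2])
    - (dxdx 0 2).smulRight (ω ![e 1, e 3]) + (dxdx 0 1).smulRight (ω ![e 2, e 3])

/-- The anti-self-dual part `ω⁻ = (ω - ⋆ω) / 2` of a two-form. -/
noncomputable def asdPart (ω : E4 [⋀^Fin 2]→L[ℝ] ℍ) : E4 [⋀^Fin 2]→L[ℝ] ℍ :=
  (1 / 2 : ℝ) • (ω - hodgeStar ω)

/-- The square `|ω|²` of the Euclidean norm of a quaternion-valued two-form, for which the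
`dx_i ∧ dx_j` with `i < j` are orthonormal. -/
noncomputable def normSqTwoForm (ω : E4 [⋀^Fin 2]→L[ℝ] ℍ) : ℝ :=
  ∑ i : Fin 4, ∑ j ∈ Finset.Ioi i, ‖ω ![e i, e j]‖ ^ 2

/-- `F(p) = ∫_{B⁴} |(dh_p)⁻|² dx`. -/
noncomputable def F (p : E4) : ℝ :=
  ∫ x in ball (0 : E4) 1, normSqTwoForm (asdPart (extDeriv (hForm p) x))

/-- The distance `d(p) = 1 - |p|` from `p ∈ B⁴` to `∂B⁴`. -/
noncomputable def bdryDist (p : E4) : ℝ := 1 - ‖p‖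

/-- The filter describing `p → ∂B⁴` with `p ∈ B⁴`: the norm `|p|` tends to `1` from below. -/
noncomputable def toBoundary : Filter E4 := comap (fun p : E4 => ‖p‖) (𝓝[<] 1)

end YMDirichlet

namespace YMDirichlet

open Laplacian

/-! ### Maximum principle and uniqueness for the Dirichlet problem on the unit ball. -/

section MaximumPrinciple

variable {E G : Type*} [NormedAddCommGroup E] [InnerProductSpace ℝ E]
  [NormedAddCommGroup G] [NormedSpace ℝ G]

/-! Everything is explicit. With `D = 1 - 2⟨x,p⟩ + |x|²|p|²`, the Kelvin transform in `x` of the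
Newton potential `|x - p|⁻²` is `1 / D`. Half its gradient in `p` is `kelvinField p x`, which is
harmonic in `x` on the ball and equals `(x - p) / |x - p|⁴` on the sphere. So `imForm (kelvinField p
x)` solves the Dirichlet problem, and the maximum principle (`eqOn_closedBall_of_harmonicContOnCl`)
identifies it with `hForm p` on the closed ball.

Differentiating, `|(dh_p)⁻|²` depends only on `⟨x,p⟩` and `|x|²|p|²`
(`normSqTwoForm_asdPart_extDeriv_hForm`). After a rotation taking `p` to the first axis, the
integral over the ball is one of a zonal function (`integral_ball_zonal`), and both the angular and
the radial integrals have elementary primitives (`integral_sin_sq_mul_asdDensity`,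
`integral_radial`). With `q = |p|²` and a constant `K > 0` this gives

`F(p) = K (24 + 3q + 4q² - q³) / (1 - q)⁴` (`F_eq_fProfile`).

Positivity and differentiability are read off. Since `1 - q = d(p) (1 + |p|)`, so are the
asymptotics, with `C₁ = 15K/8` and `C₂ = 15K/2`; uniformity in the direction holds because the
scalar coefficients depend on `|p|` alone. -/

theorem hasDerivAt_comp_line {f : E → G} {x v : E} {t : ℝ}
    (hf : DifferentiableAt ℝ f (x + t • v)) :
    HasDerivAt (fun s : ℝ => f (x + s • v)) (fderiv ℝ f (x + t • v) v) t := by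
  have h1 : HasDerivAt (fun s : ℝ => x + s • v) v t := by
    simpa using ((hasDerivAt_id t).smul_const v).const_add x
  exact hf.hasFDerivAt.comp_hasDerivAt t h1

theorem tendsto_line (x v : E) : Tendsto (fun s : ℝ => x + s • v) (𝓝 0) (𝓝 x) := by
  have : Continuous fun s : ℝ => x + s • v := by fun_prop
  simpa using this.tendsto 0

/-- The second derivative along a line computes the Hessian on the diagonal. -/
theorem deriv_deriv_comp_line {f : E → G} {x : E} (v : E) (hf : ContDiffAt ℝ 2 f x) :
    deriv (deriv fun s : ℝ => f (x + s • v)) 0 = iteratedFDeriv ℝ 2 f x ![v, v] := by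
  have h1 : ∀ᶠ y in 𝓝 x, DifferentiableAt ℝ f y := by
    filter_upwards [hf.eventually (by simp)] with y hy using hy.differentiableAt (by simp)
  have h2 : deriv (fun s : ℝ => f (x + s • v)) =ᶠ[𝓝 0] fun s => fderiv ℝ f (x + s • v) v := by
    filter_upwards [(tendsto_line x v).eventually h1] with s hs
    exact (hasDerivAt_comp_line hs).deriv
  have h3 : DifferentiableAt ℝ (fderiv ℝ f) (x + (0 : ℝ) • v) := by
    simpa using (hf.fderiv_right (m := 1) (by norm_num)).differentiableAt (by simp)
  have h4 := ((ContinuousLinearMap.apply ℝ G v).hasFDerivAt.comp_hasDerivAt (0 : ℝ)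
    (hasDerivAt_comp_line h3))
  rw [h2.deriv_eq, iteratedFDeriv_two_apply]
  simpa [Function.comp_def] using h4.deriv

theorem iteratedFDeriv_two_nonpos_of_isLocalMax {f : E → ℝ} {x : E} (hf : ContDiffAt ℝ 2 f x)
    (hx : IsLocalMax f x) (v : E) : iteratedFDeriv ℝ 2 f x ![v, v] ≤ 0 := by
  by_contra! hpos
  rw [← deriv_deriv_comp_line v hf] at hpos
  set g : ℝ → ℝ := fun s => f (x + s • v) with hg
  have hmax : IsLocalMax g 0 := by
    have := (tendsto_line x v).eventually hx
    simpa [IsLocalMax, IsMaxFilter, hg] using this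
  have hcont : ContinuousAt g 0 := by
    have : ContinuousAt f (x + (0 : ℝ) • v) := by simpa using hf.continuousAt
    exact ContinuousAt.comp (f := fun s : ℝ => x + s • v) this (by fun_prop)
  -- A positive second derivative would make the local maximum a local minimum too, hence `g`
  -- locally constant with vanishing second derivative.
  have hmin : IsLocalMin g 0 := isLocalMin_of_deriv_deriv_pos hpos hmax.deriv_eq_zero hcont
  have hconst : g =ᶠ[𝓝 0] fun _ => g 0 := by
    filter_upwards [hmax, hmin] with s h1 h2 using le_antisymm h1 h2
  have : deriv (deriv g) 0 = 0 := by
    rw [hconst.deriv.deriv_eq]; simp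
  linarith

theorem iteratedFDeriv_two_norm_sq (x v : E) :
    iteratedFDeriv ℝ 2 (fun y : E => ‖y‖ ^ 2) x ![v, v] = 2 * ‖v‖ ^ 2 := by
  rw [← deriv_deriv_comp_line v (contDiff_norm_sq ℝ).contDiffAt]
  have h : (fun s : ℝ => ‖x + s • v‖ ^ 2)
      = fun s : ℝ => ‖x‖ ^ 2 + 2 * ⟪x, v⟫_ℝ * s + ‖v‖ ^ 2 * s ^ 2 := by
    ext s
    rw [norm_add_sq_real, norm_smul, inner_smul_right, mul_pow, Real.norm_eq_abs, sq_abs]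
    ring
  have h1 : deriv (fun s : ℝ => ‖x + s • v‖ ^ 2)
      = fun s : ℝ => 2 * ⟪x, v⟫_ℝ + 2 * ‖v‖ ^ 2 * s := by
    ext s
    rw [h]
    have := (((hasDerivAt_id s).const_mul (2 * ⟪x, v⟫_ℝ)).const_add (‖x‖ ^ 2)).add
      (((hasDerivAt_id s).pow 2).const_mul (‖v‖ ^ 2))
    refine (this.congr_deriv ?_).deriv
    simp; ring
  rw [h1]
  simp

variable [FiniteDimensional ℝ E]

theorem laplacian_nonpos_of_isLocalMax {f : E → ℝ} {x : E} (hf : ContDiffAt ℝ 2 f x)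
    (hx : IsLocalMax f x) : (Δ f) x ≤ 0 := by
  rw [laplacian_eq_iteratedFDeriv_orthonormalBasis f (stdOrthonormalBasis ℝ E)]
  exact Finset.sum_nonpos fun i _ => iteratedFDeriv_two_nonpos_of_isLocalMax hf hx _

theorem laplacian_norm_sq (x : E) :
    (Δ fun y : E => ‖y‖ ^ 2) x = 2 * (Module.finrank ℝ E : ℝ) := by
  rw [laplacian_eq_iteratedFDeriv_orthonormalBasis _ (stdOrthonormalBasis ℝ E)]
  simp [iteratedFDeriv_two_norm_sq, mul_comm]

/-- Adding `ε|y|²` makes the Laplacian strictly positive, which rules out an interior maximum. -/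
theorem nonpos_of_harmonicContOnCl [Nontrivial E] {f : E → ℝ}
    (hf : HarmonicContOnCl f (ball 0 1)) (h0 : ∀ x ∈ sphere (0 : E) 1, f x ≤ 0) :
    ∀ x ∈ closedBall (0 : E) 1, f x ≤ 0 := by
  intro x hx
  by_contra! hpos
  -- Small enough that on the sphere `w ≤ ε < f x ≤ w x`, so the maximum of `w` is not attained
  -- there.
  set ε := f x / 2 with hε
  set w : E → ℝ := f + ε • fun y : E => ‖y‖ ^ 2 with hw
  have hwc : ContinuousOn w (closedBall 0 1) :=
    hf.continuousOn_ball.add (by fun_prop)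
  obtain ⟨y, hy, hmax⟩ := (isCompact_closedBall (0 : E) 1).exists_isMaxOn ⟨x, hx⟩ hwc
  have hyb : y ∈ ball (0 : E) 1 := by
    by_contra hyb
    have hys : y ∈ sphere (0 : E) 1 := by
      simp only [mem_closedBall, mem_ball, mem_sphere] at *
      linarith
    have h1 : w x ≤ w y := hmax hx
    have h2 := h0 y hys
    have h3 : ‖y‖ = 1 := by simpa using hys
    simp only [hw, Pi.add_apply, Pi.smul_apply, smul_eq_mul, h3] at h1
    have : 0 ≤ ε * ‖x‖ ^ 2 := by positivity
    linarith
  have hloc : IsLocalMax w y :=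
    hmax.isLocalMax (mem_of_superset (isOpen_ball.mem_nhds hyb) ball_subset_closedBall)
  have hq : ContDiffAt ℝ 2 (fun y : E => ‖y‖ ^ 2) y := (contDiff_norm_sq ℝ).contDiffAt
  have hq' : ContDiffAt ℝ 2 (ε • fun y : E => ‖y‖ ^ 2) y := hq.const_smul ε
  have hl : (Δ w) y ≤ 0 := laplacian_nonpos_of_isLocalMax
    ((hf.contDiffAt hyb).add hq') hloc
  have h0 : (Δ f) y = 0 := (hf.1 y hyb).2.self_of_nhds
  rw [hw, (hf.contDiffAt hyb).laplacian_add hq', laplacian_smul _ hq,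
    laplacian_norm_sq, h0] at hl
  have : 0 < Module.finrank ℝ E := Module.finrank_pos
  have h5 : (0 : ℝ) < ε * (2 * Module.finrank ℝ E) := by positivity
  simp only [smul_eq_mul] at hl
  linarith

/-- Continuous linear functionals separate points and preserve harmonicity, which reduces vector
values to the real maximum principle. -/
theorem eqOn_closedBall_of_harmonicContOnCl [Nontrivial E] {f g : E → G}
    (hf : HarmonicContOnCl f (ball 0 1)) (hg : HarmonicContOnCl g (ball 0 1))
    (h : EqOn f g (sphere (0 : E) 1)) : EqOn f g (closedBall (0 : E) 1) := by
  intro x hx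
  refine (SeparatingDual.eq_iff_forall_dual_eq (R := ℝ)).2 fun l => ?_
  have key : ∀ {f g : E → G}, HarmonicContOnCl f (ball 0 1) → HarmonicContOnCl g (ball 0 1) →
      EqOn f g (sphere (0 : E) 1) → l (f x) ≤ l (g x) := by
    intro f g hf hg h
    have hd := hf.sub hg
    have hl : HarmonicContOnCl (l ∘ (f - g)) (ball (0 : E) 1) :=
      ⟨hd.1.comp_CLM l, l.continuous.comp_continuousOn hd.2⟩
    have := nonpos_of_harmonicContOnCl hl (fun y hy => by simp [h hy]) x hx
    simpa using this
  exact le_antisymm (key hf hg h) (key hg hf h.symm)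

end MaximumPrinciple

/-! ### The Kelvin transformed field and its harmonicity in dimension four. -/

section KelvinField

variable {E : Type*} [NormedAddCommGroup E] [InnerProductSpace ℝ E]

/-- The denominator `1 - 2⟨x, p⟩ + |x|²|p|²` of the Kelvin transformed Newton potential. -/
noncomputable def kelvinDen (p x : E) : ℝ := 1 - 2 * ⟪x, p⟫_ℝ + ‖x‖ ^ 2 * ‖p‖ ^ 2

/-- The field `(x - |x|² p) / (1 - 2⟨x, p⟩ + |x|²|p|²)²`, harmonic in `x` and equal to
`(x - p) / |x - p| ^ 4` on the unit sphere. -/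
noncomputable def kelvinField (p x : E) : E := (kelvinDen p x ^ 2)⁻¹ • (x - ‖x‖ ^ 2 • p)

theorem kelvinDen_pos {p x : E} (hp : ‖p‖ < 1) (hx : ‖x‖ ≤ 1) : 0 < kelvinDen p x := by
  have h1 : ⟪x, p⟫_ℝ ≤ ‖x‖ * ‖p‖ := real_inner_le_norm x p
  have h2 : ‖x‖ * ‖p‖ < 1 := by nlinarith [norm_nonneg x, norm_nonneg p]
  unfold kelvinDen
  nlinarith

theorem kelvinDen_of_norm_eq_one {p x : E} (hx : ‖x‖ = 1) : kelvinDen p x = ‖x - p‖ ^ 2 := by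
  rw [norm_sub_sq_real, kelvinDen, hx]; ring

theorem kelvinField_of_norm_eq_one {p x : E} (hx : ‖x‖ = 1) :
    kelvinField p x = (1 / ‖x - p‖ ^ 4) • (x - p) := by
  rw [kelvinField, kelvinDen_of_norm_eq_one hx, hx]
  norm_num [← pow_mul]

theorem contDiff_kelvinDen (p : E) {n : WithTop ℕ∞} : ContDiff ℝ n (kelvinDen p) := by
  unfold kelvinDen
  have : ContDiff ℝ n fun x : E => ‖x‖ ^ 2 := contDiff_norm_sq ℝ
  exact (contDiff_const.sub (contDiff_const.mul (contDiff_id.inner ℝ contDiff_const))).add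
    (this.mul contDiff_const)

theorem contDiffAt_kelvinField {p x : E} (h : kelvinDen p x ≠ 0) {n : WithTop ℕ∞} :
    ContDiffAt ℝ n (kelvinField p) x := by
  have h1 : ContDiff ℝ n fun x : E => ‖x‖ ^ 2 := contDiff_norm_sq ℝ
  have h2 : ContDiff ℝ n fun x : E => x - ‖x‖ ^ 2 • p := by fun_prop
  exact (((contDiff_kelvinDen p).contDiffAt.pow 2).inv (by positivity)).smul h2.contDiffAt

/-- Along a line, `kelvinDen` and the numerator of `kelvinField` are both quadratic polynomials in
the parameter; this is the resulting second derivative. -/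
theorem deriv_deriv_quadratic_div {d₀ : ℝ} (hd : d₀ ≠ 0) (d₁ d₂ : ℝ) (n₀ n₁ n₂ : E) :
    deriv (deriv fun t : ℝ =>
        ((d₀ + d₁ * t + d₂ * t ^ 2) ^ 2)⁻¹ • (n₀ + t • n₁ + t ^ 2 • n₂)) 0
      = (6 * d₁ ^ 2 / d₀ ^ 4 - 4 * d₂ / d₀ ^ 3) • n₀ - (4 * d₁ / d₀ ^ 3) • n₁
        + (2 / d₀ ^ 2) • n₂ := by
  set d : ℝ → ℝ := fun t => d₀ + d₁ * t + d₂ * t ^ 2 with hd'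
  have hdd : ∀ t, HasDerivAt d (d₁ + 2 * d₂ * t) t := fun t => by
    have := (((hasDerivAt_id t).const_mul d₁).const_add d₀).add
      (((hasDerivAt_id t).pow 2).const_mul d₂)
    refine this.congr_deriv ?_
    simp; ring
  have hn : ∀ t : ℝ, HasDerivAt (fun t : ℝ => n₀ + t • n₁ + t ^ 2 • n₂)
      (n₁ + (2 * t) • n₂) t := fun t => by
    have := (((hasDerivAt_id t).smul_const n₁).const_add n₀).add
      (((hasDerivAt_id t).pow 2).smul_const n₂)
    refine this.congr_deriv ?_
    simp
  have hn' : HasDerivAt (fun t : ℝ => n₁ + (2 * t) • n₂) ((2 : ℝ) • n₂) 0 := by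
    have := (((hasDerivAt_id (0 : ℝ)).const_mul 2).smul_const n₂).const_add n₁
    simpa using this
  have hd0 : d 0 = d₀ := by simp [hd']
  have hne : ∀ᶠ t in 𝓝 (0 : ℝ), d t ≠ 0 :=
    (hdd 0).continuousAt.eventually_ne (by rwa [hd0])
  have h1 : deriv (fun t : ℝ => (d t ^ 2)⁻¹ • (n₀ + t • n₁ + t ^ 2 • n₂)) =ᶠ[𝓝 0]
      fun t => (d t ^ 2)⁻¹ • (n₁ + (2 * t) • n₂)
        + (-(2 * (d₁ + 2 * d₂ * t)) * (d t ^ 3)⁻¹) • (n₀ + t • n₁ + t ^ 2 • n₂) := by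
    filter_upwards [hne] with t ht
    have := (((hdd t).pow 2).inv (pow_ne_zero 2 ht)).smul (hn t)
    refine this.deriv.trans ?_
    congr 2
    simp only [Pi.pow_apply]
    field_simp
    ring
  have hlin : HasDerivAt (fun t : ℝ => -(2 * (d₁ + 2 * d₂ * t))) (-(4 * d₂)) 0 := by
    have := ((((hasDerivAt_id (0 : ℝ)).const_mul (2 * d₂)).const_add d₁).const_mul 2).neg
    refine this.congr_deriv ?_
    ring
  have hz : d 0 ≠ 0 := by rwa [hd0]
  have h2 := ((((hdd 0).pow 2).inv (pow_ne_zero 2 hz)).smul hn').add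
    ((hlin.mul (((hdd 0).pow 3).inv (pow_ne_zero 3 hz))).smul (hn 0))
  rw [h1.deriv_eq]
  refine h2.deriv.trans ?_
  simp only [Pi.pow_apply, Pi.mul_apply, Pi.inv_apply, hd0]
  simp only [mul_zero, add_zero, zero_smul, ne_eq, OfNat.ofNat_ne_zero, not_false_eq_true,
    zero_pow]
  match_scalars <;> field_simp <;> ring

theorem iteratedFDeriv_two_kelvinField {p x : E} (h : kelvinDen p x ≠ 0) (v : E) :
    iteratedFDeriv ℝ 2 (kelvinField p) x ![v, v]
      = (6 * (2 * ‖p‖ ^ 2 * ⟪x, v⟫_ℝ - 2 * ⟪v, p⟫_ℝ) ^ 2 / kelvinDen p x ^ 4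
          - 4 * (‖v‖ ^ 2 * ‖p‖ ^ 2) / kelvinDen p x ^ 3) • (x - ‖x‖ ^ 2 • p)
        - (4 * (2 * ‖p‖ ^ 2 * ⟪x, v⟫_ℝ - 2 * ⟪v, p⟫_ℝ) / kelvinDen p x ^ 3)
            • (v - (2 * ⟪x, v⟫_ℝ) • p)
        + (2 / kelvinDen p x ^ 2) • (-(‖v‖ ^ 2 • p)) := by
  rw [← deriv_deriv_comp_line v (contDiffAt_kelvinField h), ← deriv_deriv_quadratic_div h]
  congr 2
  ext1 t
  have hn : ‖x + t • v‖ ^ 2 = ‖x‖ ^ 2 + 2 * ⟪x, v⟫_ℝ * t + ‖v‖ ^ 2 * t ^ 2 := by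
    rw [norm_add_sq_real, norm_smul, inner_smul_right, mul_pow, Real.norm_eq_abs, sq_abs]
    ring
  rw [kelvinField, kelvinDen, kelvinDen, hn, inner_add_left, inner_smul_left]
  congr 1
  · congr 2
    simp
    ring
  · module

/-- Summing the Hessian over an orthonormal basis, the coefficient of `x` cancels because the
dimension is four, and that of `p` by the definition of `kelvinDen`. -/
theorem laplacian_kelvinField {p x : E4} (h : kelvinDen p x ≠ 0) :
    (Δ (kelvinField p)) x = 0 := by
  set b := stdOrthonormalBasis ℝ E4
  rw [laplacian_eq_iteratedFDeriv_orthonormalBasis _ b]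
  simp only [iteratedFDeriv_two_kelvinField h, b.norm_eq_one]
  -- `w` is the gradient of `kelvinDen p` at `x`; the identity `|w|² = 4|p|² D` below drives the
  -- cancellation.
  set w : E4 := (2 * ‖p‖ ^ 2) • x - (2 : ℝ) • p with hw
  have hbw : ∀ i, 2 * ‖p‖ ^ 2 * ⟪x, b i⟫_ℝ - 2 * ⟪b i, p⟫_ℝ = ⟪w, b i⟫_ℝ := fun i => by
    rw [hw, inner_sub_left, inner_smul_left, inner_smul_left, real_inner_comm p]; simp
  have h1 : ∑ i, ⟪w, b i⟫_ℝ ^ 2 = ‖w‖ ^ 2 := by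
    rw [← real_inner_self_eq_norm_sq, ← b.sum_inner_mul_inner]
    exact Finset.sum_congr rfl fun i _ => by rw [sq, real_inner_comm w (b i)]
  have h2 : ∑ i, ⟪w, b i⟫_ℝ • b i = w := by
    conv_rhs => rw [← b.sum_repr' w]
    exact Finset.sum_congr rfl fun i _ => by rw [real_inner_comm]
  have h3 : ∑ i, ⟪w, b i⟫_ℝ * ⟪x, b i⟫_ℝ = ⟪w, x⟫_ℝ := by
    rw [← b.sum_inner_mul_inner]
    exact Finset.sum_congr rfl fun i _ => by rw [real_inner_comm x (b i)]
  have h4 : ‖w‖ ^ 2 = 4 * ‖p‖ ^ 2 * kelvinDen p x := by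
    rw [hw, norm_sub_sq_real, norm_smul, norm_smul, inner_smul_left, inner_smul_right, kelvinDen]
    simp [mul_pow]
    ring
  have h5 : ⟪w, x⟫_ℝ = 2 * ‖p‖ ^ 2 * ‖x‖ ^ 2 - 2 * ⟪x, p⟫_ℝ := by
    rw [hw, inner_sub_left, inner_smul_left, inner_smul_left, real_inner_self_eq_norm_sq,
      real_inner_comm]
    simp
  simp only [hbw]
  set D := kelvinDen p x with hD
  have h6 : ∀ i, (6 * ⟪w, b i⟫_ℝ ^ 2 / D ^ 4 - 4 * (1 ^ 2 * ‖p‖ ^ 2) / D ^ 3) • (x - ‖x‖ ^ 2 • p)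
        - (4 * ⟪w, b i⟫_ℝ / D ^ 3) • (b i - (2 * ⟪x, b i⟫_ℝ) • p)
        + (2 / D ^ 2) • (-((1 : ℝ) ^ 2 • p))
      = ⟪w, b i⟫_ℝ ^ 2 • ((6 / D ^ 4) • (x - ‖x‖ ^ 2 • p)) - (4 / D ^ 3) • (⟪w, b i⟫_ℝ • b i)
        + (⟪w, b i⟫_ℝ * ⟪x, b i⟫_ℝ) • ((8 / D ^ 3) • p)
        - ((4 * ‖p‖ ^ 2 / D ^ 3) • (x - ‖x‖ ^ 2 • p) + (2 / D ^ 2) • p) := fun i => by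
    module
  simp only [h6, Finset.sum_sub_distrib, Finset.sum_add_distrib, ← Finset.sum_smul,
    ← Finset.smul_sum, h1, h2, h3, Finset.sum_const, h4, h5, Finset.card_univ, Fintype.card_fin,
    finrank_euclideanSpace]
  have h7 : ‖x‖ ^ 2 * ‖p‖ ^ 2 = D - 1 + 2 * ⟪x, p⟫_ℝ := by rw [hD, kelvinDen]; ring
  clear_value D
  rw [hw]
  match_scalars
  · push_cast [nsmul_eq_mul]
    field_simp
    ring
  · push_cast [nsmul_eq_mul]
    field_simp
    linear_combination 8 * h7

end KelvinField

/-! ### The explicit solution `h_p` and the pointwise norm of `(dh_p)⁻`. -/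

/-- The one-form `Im (ā dx)` associated with a vector `a`, linearly in `a`. -/
noncomputable def imForm : E4 →L[ℝ] E4 [⋀^Fin 1]→L[ℝ] ℍ :=
  LinearMap.toContinuousLinearMap
    { toFun := fun a => ContinuousAlternatingMap.ofSubsingleton ℝ E4 ℍ 0
        (imPart.comp ((ContinuousLinearMap.mul ℝ ℍ (star (toQuat a))).comp toQuat))
      map_add' := fun a b => by
        ext v : 1
        change imPart (star (toQuat (a + b)) * toQuat (v 0))
          = imPart (star (toQuat a) * toQuat (v 0)) + imPart (star (toQuat b) * toQuat (v 0))
        rw [map_add, star_add, add_mul, map_add]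
      map_smul' := fun c a => by
        ext v : 1
        change imPart (star (toQuat (c • a)) * toQuat (v 0))
          = c • imPart (star (toQuat a) * toQuat (v 0))
        rw [map_smul, Quaternion.star_smul, smul_mul_assoc, map_smul] }

theorem imForm_apply (a : E4) (v : Fin 1 → E4) :
    imForm a v = (star (toQuat a) * toQuat (v 0)).im := rfl

theorem boundaryForm_eq_imForm (p x : E4) :
    boundaryForm p x = imForm ((1 / ‖x - p‖ ^ 4) • (x - p)) := by
  ext v : 1
  rw [map_smul, boundaryForm_apply]
  rfl

/-- `imForm` is a constant-coefficient linear map, so harmonicity and boundary values pass from the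
field to the form. -/
theorem isDirichletSolution_imForm_kelvinField {p : E4} (hp : ‖p‖ < 1) :
    IsDirichletSolution p fun x => imForm (kelvinField p x) := by
  have hne : ∀ x : E4, ‖x‖ ≤ 1 → kelvinDen p x ≠ 0 := fun x hx => (kelvinDen_pos hp hx).ne'
  refine ⟨HarmonicContOnCl.mk_ball ?_ ?_, ?_⟩
  · refine HarmonicOnNhd.comp_CLM (F := E4) (G := E4 [⋀^Fin 1]→L[ℝ] ℍ)
      (f := kelvinField p) (fun x hx => ?_) imForm
    have hx1 : ‖x‖ ≤ 1 := by simpa using (mem_ball.1 hx).le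
    refine ⟨contDiffAt_kelvinField (hne x hx1), ?_⟩
    filter_upwards [isOpen_ball.mem_nhds hx] with y hy
    exact laplacian_kelvinField (hne y (by simpa using (mem_ball.1 hy).le))
  · refine imForm.continuous.comp_continuousOn fun x hx => ?_
    exact (contDiffAt_kelvinField (n := 0) (hne x (by simpa using hx))).continuousAt
      |>.continuousWithinAt
  · intro x hx
    rw [boundaryForm_eq_imForm, ← kelvinField_of_norm_eq_one (by simpa using hx)]

theorem isDirichletSolution_hForm {p : E4} (hp : ‖p‖ < 1) : IsDirichletSolution p (hForm p) := by
  have h : ∃ u, IsDirichletSolution p u := ⟨_, isDirichletSolution_imForm_kelvinField hp⟩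
  rw [hForm, dif_pos h]
  exact h.choose_spec

theorem IsDirichletSolution.eqOn {p : E4} {u w : E4 → E4 [⋀^Fin 1]→L[ℝ] ℍ}
    (hu : IsDirichletSolution p u) (hw : IsDirichletSolution p w) :
    EqOn u w (closedBall 0 1) :=
  eqOn_closedBall_of_harmonicContOnCl hu.1 hw.1 (hu.2.trans hw.2.symm)

theorem hForm_eqOn {p : E4} (hp : ‖p‖ < 1) :
    EqOn (hForm p) (fun x => imForm (kelvinField p x)) (closedBall 0 1) :=
  (isDirichletSolution_hForm hp).eqOn (isDirichletSolution_imForm_kelvinField hp)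

theorem extDeriv_imForm_apply {a : E4 → E4} {a' : E4 →L[ℝ] E4} {x : E4}
    (ha : HasFDerivAt a a' x) (v w : E4) :
    extDeriv (fun y => imForm (a y)) x ![v, w] = imForm (a' v) ![w] - imForm (a' w) ![v] := by
  have h0 : HasFDerivAt (fun a : E4 => imForm a) imForm (a x) := imForm.hasFDerivAt
  have h1 : HasFDerivAt (fun y => imForm (a y)) (imForm.comp a') x :=
    HasFDerivAt.comp (G := E4 [⋀^Fin 1]→L[ℝ] ℍ) x h0 ha
  have h2 : ∀ z : Fin 1 → E4, ∀ v : E4,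
      fderiv ℝ (fun y => imForm (a y) z) x v = imForm (a' v) z := fun z v => by
    have h3 := (((ContinuousAlternatingMap.apply ℝ E4 ℍ z).comp imForm).hasFDerivAt.comp x ha).fderiv
    exact congrArg (fun L : E4 →L[ℝ] ℍ => L v) h3
  rw [extDeriv_apply h1.differentiableAt]
  simp only [h2]
  simp [Fin.sum_univ_two, sub_eq_add_neg]
  rfl

theorem e_apply (i j : Fin 4) : e i j = if j = i then 1 else 0 := by
  simp [e]

theorem quaternion_norm_sq (q : ℍ) : ‖q‖ ^ 2 = q.re ^ 2 + q.imI ^ 2 + q.imJ ^ 2 + q.imK ^ 2 := by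
  rw [sq, ← Quaternion.normSq_eq_norm_mul_self, Quaternion.normSq_def']

/-- The pointwise norm of the anti-self-dual part in terms of the coefficients of the two-form. -/
theorem normSqTwoForm_asdPart (ω : E4 [⋀^Fin 2]→L[ℝ] ℍ) :
    normSqTwoForm (asdPart ω) = 1 / 2 * (‖ω ![e 0, e 1] - ω ![e 2, e 3]‖ ^ 2
      + ‖ω ![e 0, e 2] + ω ![e 1, e 3]‖ ^ 2 + ‖ω ![e 0, e 3] - ω ![e 1, e 2]‖ ^ 2) := by
  have hI0 : Finset.Ioi (0 : Fin 4) = {1, 2, 3} := by decide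
  have hI1 : Finset.Ioi (1 : Fin 4) = {2, 3} := by decide
  have hI2 : Finset.Ioi (2 : Fin 4) = {3} := by decide
  have hI3 : Finset.Ioi (3 : Fin 4) = ∅ := by decide
  simp only [normSqTwoForm, Fin.sum_univ_four, hI0, hI1, hI2, hI3]
  simp [asdPart, hodgeStar, dxdx_apply, e_apply, quaternion_norm_sq]
  ring

/-- The density for `d (Im (ā dx))` with `a` of derivative `M`. -/
theorem normSqTwoForm_asdPart_of_imForm (ω : E4 [⋀^Fin 2]→L[ℝ] ℍ) (M : Fin 4 → E4)
    (h : ∀ k l, ω ![e k, e l] = imForm (M k) ![e l] - imForm (M l) ![e k]) :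
    normSqTwoForm (asdPart ω) = 3 / 2 * (M 0 0 + M 1 1 + M 2 2 + M 3 3) ^ 2
      + (M 0 1 - M 1 0 - (M 2 3 - M 3 2)) ^ 2 + (M 0 2 - M 2 0 + (M 1 3 - M 3 1)) ^ 2
      + (M 0 3 - M 3 0 - (M 1 2 - M 2 1)) ^ 2 := by
  rw [normSqTwoForm_asdPart]
  have h0 : ∀ x, (toQuat x).re = x 0 := fun _ => rfl
  have h1 : ∀ x, (toQuat x).imI = x 1 := fun _ => rfl
  have h2 : ∀ x, (toQuat x).imJ = x 2 := fun _ => rfl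
  have h3 : ∀ x, (toQuat x).imK = x 3 := fun _ => rfl
  simp only [h, imForm_apply, quaternion_norm_sq]
  simp [h0, h1, h2, h3, e_apply]
  ring

/-- Smoothness is already known, so the derivative is identified by differentiating along lines. -/
theorem hasFDerivAt_kelvinField {E : Type*} [NormedAddCommGroup E] [InnerProductSpace ℝ E]
    {p x : E} (h : kelvinDen p x ≠ 0) : ∃ a' : E →L[ℝ] E, HasFDerivAt (kelvinField p) a' x ∧
      ∀ v, a' v = (kelvinDen p x ^ 2)⁻¹ • (v - (2 * ⟪x, v⟫_ℝ) • p)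
        - (2 * (2 * ‖p‖ ^ 2 * ⟪x, v⟫_ℝ - 2 * ⟪v, p⟫_ℝ) * (kelvinDen p x ^ 3)⁻¹)
          • (x - ‖x‖ ^ 2 • p) := by
  have hd : DifferentiableAt ℝ (kelvinField p) x :=
    (contDiffAt_kelvinField (n := 1) h).differentiableAt (by simp)
  refine ⟨_, hd.hasFDerivAt, fun v => ?_⟩
  have h0 : DifferentiableAt ℝ (kelvinField p) (x + (0 : ℝ) • v) := by simpa using hd
  have h1 := hasDerivAt_comp_line h0
  simp only [zero_smul, add_zero] at h1
  refine h1.unique ?_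
  have hline : HasDerivAt (fun s : ℝ => x + s • v) v 0 := by
    simpa using ((hasDerivAt_id (0 : ℝ)).smul_const v).const_add x
  have hn : HasDerivAt (fun s : ℝ => ‖x + s • v‖ ^ 2) (2 * ⟪x, v⟫_ℝ) 0 := by
    simpa using hline.norm_sq
  have hi : HasDerivAt (fun s : ℝ => ⟪x + s • v, p⟫_ℝ) ⟪v, p⟫_ℝ 0 := by
    simpa using hline.inner ℝ (hasDerivAt_const (0 : ℝ) p)
  have hD : HasDerivAt (fun s : ℝ => kelvinDen p (x + s • v))
      (2 * ‖p‖ ^ 2 * ⟪x, v⟫_ℝ - 2 * ⟪v, p⟫_ℝ) 0 := by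
    refine (((hi.const_mul 2).const_sub 1).add (hn.mul_const (‖p‖ ^ 2))).congr_deriv ?_
    ring
  have hz : kelvinDen p (x + (0 : ℝ) • v) ≠ 0 := by simpa using h
  have := ((hD.pow 2).inv (pow_ne_zero 2 hz)).smul (hline.sub (hn.smul_const p))
  refine this.congr_deriv ?_
  simp only [Pi.pow_apply, Pi.inv_apply, Pi.sub_apply, zero_smul, add_zero]
  match_scalars <;> field_simp <;> ring

/-- The density `|(dh_p)⁻|²` as a function of `t = ⟨x, p⟩` and `s = |x|²|p|²`. -/
noncomputable def asdDensity (t s : ℝ) : ℝ :=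
  (3 / 2 * (4 - 6 * t - 4 * s + 4 * t ^ 2 + 2 * s * t) ^ 2
    + 4 * (s - t ^ 2) * (3 - 2 * t - s) ^ 2) / (1 - 2 * t + s) ^ 6

theorem normSqTwoForm_asdPart_extDeriv_hForm {p x : E4} (hp : ‖p‖ < 1) (hx : x ∈ ball (0 : E4) 1) :
    normSqTwoForm (asdPart (extDeriv (hForm p) x)) = asdDensity ⟪x, p⟫_ℝ (‖x‖ ^ 2 * ‖p‖ ^ 2) := by
  have hne : kelvinDen p x ≠ 0 := (kelvinDen_pos hp (by simpa using (mem_ball.1 hx).le)).ne'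
  have heq : hForm p =ᶠ[𝓝 x] fun x => imForm (kelvinField p x) :=
    -- The chosen solution is determined only on the closed ball, which suffices since `extDeriv` at
    -- an interior point sees only the germ.
    ((hForm_eqOn hp).mono ball_subset_closedBall).eventuallyEq_of_mem (isOpen_ball.mem_nhds hx)
  obtain ⟨a', ha', hv⟩ := hasFDerivAt_kelvinField hne
  rw [heq.extDeriv_eq, normSqTwoForm_asdPart_of_imForm _ (fun k => a' (e k))
    fun k l => extDeriv_imForm_apply ha' _ _]
  have hxe : ∀ k, ⟪x, e k⟫_ℝ = x k := fun k => by simp [e, EuclideanSpace.inner_single_right]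
  have hep : ∀ k, ⟪e k, p⟫_ℝ = p k := fun k => by simp [e, EuclideanSpace.inner_single_left]
  have h1 : ⟪x, p⟫_ℝ = x 0 * p 0 + x 1 * p 1 + x 2 * p 2 + x 3 * p 3 := by
    simp [PiLp.inner_apply, Fin.sum_univ_four, mul_comm]
  have h2 : ∀ z : E4, ‖z‖ ^ 2 = z 0 ^ 2 + z 1 ^ 2 + z 2 ^ 2 + z 3 ^ 2 := fun z => by
    simp [EuclideanSpace.norm_sq_eq, Fin.sum_univ_four]
  have hD : kelvinDen p x = 1 - 2 * ⟪x, p⟫_ℝ + ‖x‖ ^ 2 * ‖p‖ ^ 2 := rfl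
  rw [asdDensity, ← hD]
  have hM : ∀ k l, a' (e k) l = (kelvinDen p x * ((if l = k then 1 else 0) - 2 * x k * p l)
      - 4 * (‖p‖ ^ 2 * x k - p k) * (x l - ‖x‖ ^ 2 * p l)) / kelvinDen p x ^ 3 := fun k l => by
    rw [hv, hxe, hep, ← e_apply]
    simp only [PiLp.sub_apply, PiLp.smul_apply, smul_eq_mul]
    field_simp
    ring
  set D := kelvinDen p x
  have htr : a' (e 0) 0 + a' (e 1) 1 + a' (e 2) 2 + a' (e 3) 3
      = (4 - 6 * ⟪x, p⟫_ℝ - 4 * (‖x‖ ^ 2 * ‖p‖ ^ 2) + 4 * ⟪x, p⟫_ℝ ^ 2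
        + 2 * (‖x‖ ^ 2 * ‖p‖ ^ 2) * ⟪x, p⟫_ℝ) / D ^ 3 := by
    simp only [hM, if_true]
    rw [← add_div, ← add_div, ← add_div]
    congr 1
    linear_combination (4 - 2 * ⟪x, p⟫_ℝ) * hD + (2 * D - 4 * (‖p‖ ^ 2 * ‖x‖ ^ 2 + 1)) * h1
      + 4 * ‖p‖ ^ 2 * h2 x + 4 * ‖x‖ ^ 2 * h2 p
  have hanti : ∀ k l, a' (e k) l - a' (e l) k
      = 2 * (3 - 2 * ⟪x, p⟫_ℝ - ‖x‖ ^ 2 * ‖p‖ ^ 2) * (x l * p k - x k * p l) / D ^ 3 :=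
    fun k l => by
      have : (if l = k then (1 : ℝ) else 0) = if k = l then 1 else 0 := by simp only [eq_comm]
      rw [hM, hM, this, ← sub_div, hD]
      congr 1
      ring
  -- Lagrange's identity for `x ∧ p`; the cross terms vanish by the Plücker relation, as `x ∧ p` is
  -- decomposable.
  have hpl : (x 1 * p 0 - x 0 * p 1 - (x 3 * p 2 - x 2 * p 3)) ^ 2
      + (x 2 * p 0 - x 0 * p 2 + (x 3 * p 1 - x 1 * p 3)) ^ 2
      + (x 3 * p 0 - x 0 * p 3 - (x 2 * p 1 - x 1 * p 2)) ^ 2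
      = ‖x‖ ^ 2 * ‖p‖ ^ 2 - ⟪x, p⟫_ℝ ^ 2 := by
    rw [h1, h2, h2]; ring
  rw [htr, hanti, hanti, hanti, hanti, hanti, hanti, ← hpl]
  field_simp
  ring

/-! ### Integrals of zonal functions over the four-dimensional ball. -/

open Real

/-- Splitting off the first coordinate of `E4`. -/
noncomputable def splitFirst : E4 ≃ᵐ ℝ × EuclideanSpace ℝ (Fin 3) :=
  ((MeasurableEquiv.toLp 2 (Fin 4 → ℝ)).symm.trans
    (MeasurableEquiv.piFinSuccAbove (fun _ : Fin 4 => ℝ) 0)).trans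
    ((MeasurableEquiv.refl ℝ).prodCongr (MeasurableEquiv.toLp 2 (Fin 3 → ℝ)))

theorem measurePreserving_splitFirst : MeasurePreserving splitFirst :=
  ((PiLp.volume_preserving_ofLp (Fin 4)).trans
    (volume_preserving_piFinSuccAbove (fun _ : Fin 4 => ℝ) 0)).trans
    ((MeasurePreserving.id volume).prod (PiLp.volume_preserving_toLp (Fin 3)))

theorem splitFirst_fst (x : E4) : (splitFirst x).1 = x 0 := rfl

theorem norm_sq_eq_splitFirst (x : E4) : ‖x‖ ^ 2 = x 0 ^ 2 + ‖(splitFirst x).2‖ ^ 2 := by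
  rw [EuclideanSpace.norm_sq_eq, EuclideanSpace.norm_sq_eq, Fin.sum_univ_succ]
  simp only [Real.norm_eq_abs, sq_abs]
  rfl

/-- The constant in the integration formula for zonal functions on the four-dimensional ball. -/
noncomputable def zonalConst : ℝ :=
  3 / 2 * (volume : Measure (EuclideanSpace ℝ (Fin 3))).real (ball 0 1)

theorem zonalConst_pos : 0 < zonalConst := by
  have : 0 < (volume : Measure (EuclideanSpace ℝ (Fin 3))).real (ball 0 1) :=
    ENNReal.toReal_pos (measure_ball_pos _ _ one_pos).ne' measure_ball_lt_top.ne
  unfold zonalConst; positivity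

section Zonal

variable {Φ : ℝ → ℝ → ℝ}

/-- The function `Φ`, cut off at `s = 1`. -/
noncomputable def cutoff (Φ : ℝ → ℝ → ℝ) (a s : ℝ) : ℝ := if s < 1 then Φ a s else 0

theorem integrable_cutoff
    (hΦ : ContinuousOn (fun q : ℝ × ℝ => Φ q.1 q.2) {q | q.1 ^ 2 ≤ q.2 ∧ q.2 ≤ 1})
    {X : Type*} [TopologicalSpace X] [MeasurableSpace X]
    [OpensMeasurableSpace X] [T2Space X] {μ : Measure X} [IsFiniteMeasureOnCompacts μ] {a s : X → ℝ}
    (ha : Continuous a) (hs : Continuous s) (has : ∀ x, a x ^ 2 ≤ s x)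
    (hc : IsCompact {x | s x ≤ 1}) : Integrable (fun x => cutoff Φ (a x) (s x)) μ := by
  have h1 : IntegrableOn (fun x => Φ (a x) (s x)) {x | s x ≤ 1} μ :=
    ContinuousOn.integrableOn_compact hc
      (hΦ.comp (f := fun x => (a x, s x)) (by fun_prop) fun x hx => ⟨has x, hx⟩)
  have h2 : (fun x => cutoff Φ (a x) (s x)) = {x | s x < 1}.indicator fun x => Φ (a x) (s x) := by
    ext x
    simp [cutoff, indicator_apply]
  rw [h2, integrable_indicator_iff (isOpen_lt hs continuous_const).measurableSet]
  exact h1.mono_set fun x (hx : s x < 1) => show s x ≤ 1 from hx.le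

theorem integral_cutoff_eq_integral_prod (Φ : ℝ → ℝ → ℝ) :
    ∫ x : E4, cutoff Φ (x 0) (‖x‖ ^ 2)
      = ∫ z : ℝ × EuclideanSpace ℝ (Fin 3), cutoff Φ z.1 (z.1 ^ 2 + ‖z.2‖ ^ 2) := by
  rw [← measurePreserving_splitFirst.integral_comp splitFirst.measurableEmbedding]
  simp only [norm_sq_eq_splitFirst, splitFirst_fst]

/-- For a fixed first coordinate the integrand is radial in the other three, giving `3 vol(B³) ∫ b²
db` over `b > 0`. Extending evenly to all real `b` halves the constant and leaves a plane integral
suited to polar coordinates. -/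
theorem integral_cutoff_eq_integral_plane
    (hΦ : ContinuousOn (fun q : ℝ × ℝ => Φ q.1 q.2) {q | q.1 ^ 2 ≤ q.2 ∧ q.2 ≤ 1}) :
    ∫ x : E4, cutoff Φ (x 0) (‖x‖ ^ 2)
      = zonalConst * ∫ z : ℝ × ℝ, z.2 ^ 2 * cutoff Φ z.1 (z.1 ^ 2 + z.2 ^ 2) := by
  have hint : Integrable fun z : ℝ × EuclideanSpace ℝ (Fin 3) =>
      cutoff Φ z.1 (z.1 ^ 2 + ‖z.2‖ ^ 2) := by
    rw [← measurePreserving_splitFirst.integrable_comp_emb splitFirst.measurableEmbedding]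
    have : Integrable fun x : E4 => cutoff Φ (x 0) (‖x‖ ^ 2) := by
      refine integrable_cutoff hΦ (by fun_prop) (by fun_prop) (fun x => ?_) ?_
      · rw [norm_sq_eq_splitFirst]; nlinarith [sq_nonneg ‖(splitFirst x).2‖]
      · have : {x : E4 | ‖x‖ ^ 2 ≤ 1} = closedBall 0 1 := by
          ext x
          rw [mem_closedBall_zero_iff]
          exact sq_le_one_iff₀ (norm_nonneg x)
        rw [this]
        exact isCompact_closedBall 0 1
    refine this.congr (Eventually.of_forall fun x => ?_)
    simp only [Function.comp_apply, norm_sq_eq_splitFirst, splitFirst_fst]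
  have hplane : Integrable fun z : ℝ × ℝ => z.2 ^ 2 * cutoff Φ z.1 (z.1 ^ 2 + z.2 ^ 2) := by
    have hΨ : ContinuousOn (fun q : ℝ × ℝ => (q.2 - q.1 ^ 2) * Φ q.1 q.2)
        {q | q.1 ^ 2 ≤ q.2 ∧ q.2 ≤ 1} := ContinuousOn.mul (by fun_prop) hΦ
    have : Integrable fun z : ℝ × ℝ =>
        cutoff (fun a s => (s - a ^ 2) * Φ a s) z.1 (z.1 ^ 2 + z.2 ^ 2) := by
      refine integrable_cutoff hΨ (by fun_prop) (by fun_prop) (fun z => ?_) ?_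
      · nlinarith [sq_nonneg z.2]
      · refine Metric.isCompact_of_isClosed_isBounded
          (isClosed_le (by fun_prop) continuous_const) ?_
        refine (isBounded_iff_forall_norm_le).2 ⟨1, fun z (hz : z.1 ^ 2 + z.2 ^ 2 ≤ 1) => ?_⟩
        refine max_le ?_ ?_
        · exact abs_le_one_iff_mul_self_le_one.2 (by nlinarith)
        · exact abs_le_one_iff_mul_self_le_one.2 (by nlinarith)
    refine this.congr (Eventually.of_forall fun z => ?_)
    simp only [cutoff]
    split_ifs <;> ring
  rw [integral_cutoff_eq_integral_prod, Measure.volume_eq_prod, integral_prod _ hint,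
    Measure.volume_eq_prod, integral_prod _ hplane, ← integral_const_mul]
  refine integral_congr_ae (Eventually.of_forall fun a => ?_)
  have h1 := integral_fun_norm_addHaar (volume : Measure (EuclideanSpace ℝ (Fin 3)))
    fun b => cutoff Φ a (a ^ 2 + b ^ 2)
  have h2 := integral_comp_abs (f := fun b => b ^ 2 * cutoff Φ a (a ^ 2 + b ^ 2))
  simp only [sq_abs] at h2
  simp only [h1, h2, zonalConst, finrank_euclideanSpace, Fintype.card_fin, smul_eq_mul,
    nsmul_eq_mul]
  norm_num
  ring

/-- Integration of a zonal function over the four-dimensional ball in polar coordinates. -/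
theorem integral_ball_zonal
    (hΦ : ContinuousOn (fun q : ℝ × ℝ => Φ q.1 q.2) {q | q.1 ^ 2 ≤ q.2 ∧ q.2 ≤ 1}) :
    ∫ x in ball (0 : E4) 1, Φ (x 0) (‖x‖ ^ 2)
      = zonalConst * ∫ ρ in (0 : ℝ)..1, ρ ^ 3 *
          ∫ θ in (-π)..π, sin θ ^ 2 * Φ (ρ * cos θ) (ρ ^ 2) := by
  have h1 : ∫ x in ball (0 : E4) 1, Φ (x 0) (‖x‖ ^ 2) = ∫ x : E4, cutoff Φ (x 0) (‖x‖ ^ 2) := by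
    rw [← integral_indicator measurableSet_ball]
    congr 1
    ext x
    by_cases hx : ‖x‖ < 1 <;> simp [cutoff, sq_lt_one_iff₀ (norm_nonneg x), hx]
  rw [h1, integral_cutoff_eq_integral_plane hΦ, ← integral_comp_polarCoord_symm]
  congr 1
  have h2 : ∀ q : ℝ × ℝ, q.1 • ((polarCoord.symm q).2 ^ 2 * cutoff Φ (polarCoord.symm q).1
      ((polarCoord.symm q).1 ^ 2 + (polarCoord.symm q).2 ^ 2))
      = q.1 ^ 3 * (sin q.2 ^ 2 * cutoff Φ (q.1 * cos q.2) (q.1 ^ 2)) := fun q => by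
    have : (q.1 * cos q.2) ^ 2 + (q.1 * sin q.2) ^ 2 = q.1 ^ 2 := by
      rw [mul_pow, mul_pow, ← mul_add, cos_sq_add_sin_sq, mul_one]
    simp only [polarCoord_symm_apply, this, smul_eq_mul]
    ring
  simp only [h2, polarCoord_target]
  have hsub : Ioo (0 : ℝ) 1 ×ˢ Ioo (-π) π ⊆ Ioi (0 : ℝ) ×ˢ Ioo (-π) π :=
    prod_mono Ioo_subset_Ioi_self le_rfl
  rw [setIntegral_eq_of_subset_of_forall_sdiff_eq_zero
    (measurableSet_Ioi.prod measurableSet_Ioo) hsub]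
  · have hcongr : EqOn (fun q : ℝ × ℝ => q.1 ^ 3 * (sin q.2 ^ 2 * cutoff Φ (q.1 * cos q.2) (q.1 ^ 2)))
        (fun q => q.1 ^ 3 * (sin q.2 ^ 2 * Φ (q.1 * cos q.2) (q.1 ^ 2)))
        (Ioo (0 : ℝ) 1 ×ˢ Ioo (-π) π) := fun q hq => by
      have : q.1 ^ 2 < 1 := by nlinarith [hq.1.1, hq.1.2]
      simp [cutoff, this]
    have hint : IntegrableOn (fun q : ℝ × ℝ => q.1 ^ 3 * (sin q.2 ^ 2 * Φ (q.1 * cos q.2) (q.1 ^ 2)))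
        (Ioo (0 : ℝ) 1 ×ˢ Ioo (-π) π) (volume.prod volume) := by
      refine IntegrableOn.mono_set (t := Icc (0 : ℝ) 1 ×ˢ Icc (-π) π) ?_
        (prod_mono Ioo_subset_Icc_self Ioo_subset_Icc_self)
      refine ContinuousOn.integrableOn_compact (isCompact_Icc.prod isCompact_Icc) ?_
      refine ContinuousOn.mul (by fun_prop) (ContinuousOn.mul (by fun_prop) ?_)
      refine hΦ.comp (f := fun q : ℝ × ℝ => (q.1 * cos q.2, q.1 ^ 2)) (by fun_prop) fun q hq => ?_
      refine ⟨?_, by nlinarith [hq.1.1, hq.1.2]⟩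
      change (q.1 * cos q.2) ^ 2 ≤ q.1 ^ 2
      rw [mul_pow]
      exact mul_le_of_le_one_right (sq_nonneg _) (cos_sq_le_one _)
    rw [setIntegral_congr_fun (measurableSet_Ioo.prod measurableSet_Ioo) hcongr,
      Measure.volume_eq_prod, setIntegral_prod _ hint, intervalIntegral.integral_of_le zero_le_one,
      integral_Ioc_eq_integral_Ioo]
    refine setIntegral_congr_fun measurableSet_Ioo fun ρ _ => ?_
    simp only
    rw [integral_const_mul, intervalIntegral.integral_of_le (by linarith [pi_pos]),
      integral_Ioc_eq_integral_Ioo]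
  · rintro q ⟨hq1, hq2⟩
    have : ¬ q.1 ^ 2 < 1 := fun h => hq2 ⟨⟨hq1.1, by nlinarith [hq1.1.out]⟩, hq1.2⟩
    simp [cutoff, this]

end Zonal

/-! ### Elementary primitives for the angular and radial integrals. -/

/-- The polynomial part of an antiderivative of the angular density, in `v = u cos θ` and
`q = u²`. -/
def primPoly (q v : ℝ) : ℝ :=
  (-15 + 2870 * q + 4688 * q ^ 2 + 9898 * q ^ 3 + 7358 * q ^ 4 + 3178 * q ^ 5 + 848 * q ^ 6 - 10 * q ^ 7 - 15 * q ^ 8)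
    + (-585 - 17195 * q - 29385 * q ^ 2 - 42595 * q ^ 3 - 19795 * q ^ 4 - 5625 * q ^ 5 - 155 * q ^ 6 + 135 * q ^ 7) * v
    + (2410 + 41364 * q + 61974 * q ^ 2 + 53464 * q ^ 3 + 13014 * q ^ 4 + 1044 * q ^ 5 - 470 * q ^ 6) * v ^ 2
    + (-3100 - 47580 * q - 45320 * q ^ 2 - 18440 * q ^ 3 - 1500 * q ^ 4 + 740 * q ^ 5) * v ^ 3
    + (1288 + 21728 * q + 3888 * q ^ 2 + 2528 * q ^ 3 - 632 * q ^ 4) * v ^ 4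

/-- The derivative of `primPoly q`. -/
def primPolyDeriv (q v : ℝ) : ℝ :=
  (-585 - 17195 * q - 29385 * q ^ 2 - 42595 * q ^ 3 - 19795 * q ^ 4 - 5625 * q ^ 5 - 155 * q ^ 6 + 135 * q ^ 7)
    + (4820 + 82728 * q + 123948 * q ^ 2 + 106928 * q ^ 3 + 26028 * q ^ 4 + 2088 * q ^ 5 - 940 * q ^ 6) * v
    + (-9300 - 142740 * q - 135960 * q ^ 2 - 55320 * q ^ 3 - 4500 * q ^ 4 + 2220 * q ^ 5) * v ^ 2
    + (5152 + 86912 * q + 15552 * q ^ 2 + 10112 * q ^ 3 - 2528 * q ^ 4) * v ^ 3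

theorem hasDerivAt_quartic (a b c d e v : ℝ) :
    HasDerivAt (fun w : ℝ => a + b * w + c * w ^ 2 + d * w ^ 3 + e * w ^ 4)
      (b + 2 * c * v + 3 * d * v ^ 2 + 4 * e * v ^ 3) v := by
  have h := fun n : ℕ => hasDerivAt_pow n v
  have := (((((hasDerivAt_id v).const_mul b).const_add a).add ((h 2).const_mul c)).add
    ((h 3).const_mul d)).add ((h 4).const_mul e)
  refine this.congr_deriv ?_
  norm_num
  ring

theorem hasDerivAt_primPoly (q v : ℝ) : HasDerivAt (primPoly q) (primPolyDeriv q v) v := by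
  refine (hasDerivAt_quartic _ _ _ _ _ v).congr_deriv ?_
  simp only [primPolyDeriv]
  ring

/-- Hermite reduction of the pole of order six. With `v = u cos θ` and `q = u²`, the first two terms
are `u` times the `θ`-derivative of `sin θ · primPoly q v / D⁵`, leaving only a multiple of the
Poisson kernel and a constant. -/
theorem asdDensity_reduction {q v : ℝ} (hD : 1 - 2 * v + q ≠ 0) :
    60 * (1 - q) ^ 4 * (q - v ^ 2) * asdDensity v q
      = (v * primPoly q v - (q - v ^ 2) * primPolyDeriv q v) / (1 - 2 * v + q) ^ 5
        - 10 * (q - v ^ 2) * primPoly q v / (1 - 2 * v + q) ^ 6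
        + 15 / 2 * (1 + 91 * q + 124 * q ^ 2 + 28 * q ^ 3 - 5 * q ^ 4 + q ^ 5) / (1 - 2 * v + q)
        - 15 / 2 * (1 - q) ^ 4 := by
  unfold asdDensity primPoly primPolyDeriv
  -- Keeps the denominator atomic while fractions are cleared; it is expanded only for the final
  -- polynomial identity.
  obtain ⟨D, hD'⟩ : ∃ D, D = 1 - 2 * v + q := ⟨_, rfl⟩
  rw [← hD'] at hD ⊢
  field_simp
  rw [hD']
  ring

theorem one_sub_two_mul_cos_pos {u : ℝ} (hu : u ∈ Ico (0 : ℝ) 1) (θ : ℝ) :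
    0 < 1 - 2 * (u * cos θ) + u ^ 2 := by
  have h1 : u * cos θ ≤ u := mul_le_of_le_one_right hu.1 (cos_le_one θ)
  nlinarith [hu.1, hu.2]

/-- A primitive of the Poisson kernel of the disc. -/
theorem hasDerivAt_poissonPrimitive {u : ℝ} (hu : u ∈ Ico (0 : ℝ) 1) (θ : ℝ) :
    HasDerivAt (fun θ => θ + 2 * arctan (u * sin θ / (1 - u * cos θ)))
      ((1 - u ^ 2) / (1 - 2 * (u * cos θ) + u ^ 2)) θ := by
  have h1 : u * cos θ ≤ u := mul_le_of_le_one_right hu.1 (cos_le_one θ)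
  have h2 : 1 - u * cos θ ≠ 0 := by linarith [hu.2]
  have h3 := (one_sub_two_mul_cos_pos hu θ).ne'
  have h4 := (((hasDerivAt_sin θ).const_mul u).div
    (((hasDerivAt_cos θ).const_mul u).const_sub 1) h2).arctan
  refine ((hasDerivAt_id θ).add (h4.const_mul 2)).congr_deriv ?_
  have h5 : 1 + (u * sin θ / (1 - u * cos θ)) ^ 2
      = (1 - 2 * (u * cos θ) + u ^ 2) / (1 - u * cos θ) ^ 2 := by
    field_simp
    linear_combination u ^ 2 * sin_sq_add_cos_sq θ
  simp only [Pi.div_apply, h5]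
  obtain ⟨D, hD⟩ : ∃ D, D = 1 - 2 * (u * cos θ) + u ^ 2 := ⟨_, rfl⟩
  rw [← hD] at h3 ⊢
  field_simp
  rw [hD]
  linear_combination (-2 * u ^ 2) * sin_sq_add_cos_sq θ

theorem hasDerivAt_angularPrimitive {u : ℝ} (hu : u ∈ Ioo (0 : ℝ) 1) (θ : ℝ) :
    HasDerivAt (fun θ => (60 * u * (1 - u ^ 2) ^ 4)⁻¹ *
        (sin θ * primPoly (u ^ 2) (u * cos θ) / (1 - 2 * (u * cos θ) + u ^ 2) ^ 5)
        + (1 + 91 * u ^ 2 + 124 * u ^ 4 + 28 * u ^ 6 - 5 * u ^ 8 + u ^ 10)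
            / (8 * u ^ 2 * (1 - u ^ 2) ^ 5) * (θ + 2 * arctan (u * sin θ / (1 - u * cos θ)))
        - (8 * u ^ 2)⁻¹ * θ)
      (sin θ ^ 2 * asdDensity (u * cos θ) (u ^ 2)) θ := by
  have hD := (one_sub_two_mul_cos_pos ⟨hu.1.le, hu.2⟩ θ).ne'
  have hu0 : u ≠ 0 := hu.1.ne'
  have hu1 : 1 - u ^ 2 ≠ 0 := by nlinarith [hu.1, hu.2]
  have hc := (hasDerivAt_cos θ).const_mul u
  have hR : HasDerivAt (fun θ => primPoly (u ^ 2) (u * cos θ))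
      (primPolyDeriv (u ^ 2) (u * cos θ) * (u * -sin θ)) θ :=
    HasDerivAt.comp (h₂ := primPoly (u ^ 2)) θ (hasDerivAt_primPoly (u ^ 2) (u * cos θ)) hc
  have hd : HasDerivAt (fun θ => 1 - 2 * (u * cos θ) + u ^ 2) (-(2 * (u * -sin θ))) θ :=
    ((hc.const_mul 2).const_sub 1).add_const (u ^ 2)
  have h := ((((hasDerivAt_sin θ).mul hR).div (hd.pow 5) (pow_ne_zero 5 hD)).const_mul
    (60 * u * (1 - u ^ 2) ^ 4)⁻¹).add ((hasDerivAt_poissonPrimitive ⟨hu.1.le, hu.2⟩ θ).const_mul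
    ((1 + 91 * u ^ 2 + 124 * u ^ 4 + 28 * u ^ 6 - 5 * u ^ 8 + u ^ 10)
            / (8 * u ^ 2 * (1 - u ^ 2) ^ 5))) |>.sub ((hasDerivAt_id θ).const_mul (8 * u ^ 2)⁻¹)
  refine h.congr_deriv ?_
  have key := asdDensity_reduction hD
  have hs : u ^ 2 - (u * cos θ) ^ 2 = u ^ 2 * sin θ ^ 2 := by
    rw [sin_sq]; ring
  rw [hs] at key
  have h60 : 60 * u ^ 2 * (1 - u ^ 2) ^ 4 ≠ 0 := by positivity
  rw [← mul_right_inj' h60]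
  rw [show 60 * u ^ 2 * (1 - u ^ 2) ^ 4 * (sin θ ^ 2 * asdDensity (u * cos θ) (u ^ 2))
    = 60 * (1 - u ^ 2) ^ 4 * (u ^ 2 * sin θ ^ 2) * asdDensity (u * cos θ) (u ^ 2) by ring, key]
  simp only [Pi.pow_apply, Pi.mul_apply]
  generalize primPoly (u ^ 2) (u * cos θ) = R
  generalize primPolyDeriv (u ^ 2) (u * cos θ) = R'
  generalize 1 - 2 * (u * cos θ) + u ^ 2 = D at *
  push_cast
  field_simp
  ring

theorem continuous_asdDensity_cos {u : ℝ} (hu : u ∈ Ico (0 : ℝ) 1) :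
    Continuous fun θ => sin θ ^ 2 * asdDensity (u * cos θ) (u ^ 2) := by
  unfold asdDensity
  refine Continuous.mul (by fun_prop) (Continuous.div (by fun_prop) (by fun_prop) fun θ => ?_)
  exact pow_ne_zero 6 (one_sub_two_mul_cos_pos hu θ).ne'

/-- At `±π` the rational and arctangent parts of the primitive vanish with `sin θ`, so only its
terms linear in `θ` contribute. Their sum carries a factor `u²` cancelling the one in the
denominator; `u = 0`, where the primitive is singular, is computed directly. -/
theorem integral_sin_sq_mul_asdDensity {u : ℝ} (hu : u ∈ Ico (0 : ℝ) 1) :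
    ∫ θ in (-π)..π, sin θ ^ 2 * asdDensity (u * cos θ) (u ^ 2)
      = π / 2 * (48 + 57 * u ^ 2 + 19 * u ^ 4 - 5 * u ^ 6 + u ^ 8) / (1 - u ^ 2) ^ 5 := by
  rcases eq_or_lt_of_le hu.1 with rfl | hu0
  · have : ∀ θ : ℝ, sin θ ^ 2 * asdDensity (0 * cos θ) (0 ^ 2) = 24 * sin θ ^ 2 := fun θ => by
      norm_num [asdDensity]
      ring
    simp only [this, intervalIntegral.integral_const_mul, integral_sin_sq]
    norm_num
    ring
  · have hu1 : 1 - u ^ 2 ≠ 0 := by nlinarith [hu.2]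
    rw [intervalIntegral.integral_eq_sub_of_hasDerivAt
      (fun θ _ => hasDerivAt_angularPrimitive ⟨hu0, hu.2⟩ θ)
      ((continuous_asdDensity_cos hu).intervalIntegrable _ _)]
    simp only [sin_neg, cos_neg, sin_pi, neg_zero, zero_mul, zero_div, mul_zero, arctan_zero,
      add_zero, zero_add]
    field_simp
    ring

/-- In `z = ρ²q` a primitive is `(π/4) ρ⁴ (24 + 3z + 4z² - z³) / (1 - z)⁴`, which vanishes at `ρ =
0`. -/
theorem integral_radial {q : ℝ} (hq : q ∈ Ico (0 : ℝ) 1) :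
    ∫ ρ in (0 : ℝ)..1, ρ ^ 3 * (π / 2 * (48 + 57 * (ρ ^ 2 * q) + 19 * (ρ ^ 2 * q) ^ 2
        - 5 * (ρ ^ 2 * q) ^ 3 + (ρ ^ 2 * q) ^ 4) / (1 - ρ ^ 2 * q) ^ 5)
      = π / 4 * (24 + 3 * q + 4 * q ^ 2 - q ^ 3) / (1 - q) ^ 4 := by
  have hne : ∀ ρ ∈ uIcc (0 : ℝ) 1, 1 - ρ ^ 2 * q ≠ 0 := fun ρ hρ => by
    rw [uIcc_of_le zero_le_one] at hρ
    have h1 : ρ ^ 2 ≤ 1 := by nlinarith [hρ.1, hρ.2]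
    have : ρ ^ 2 * q ≤ q := mul_le_of_le_one_left hq.1 h1
    linarith [hq.2]
  have hderiv : ∀ ρ ∈ uIcc (0 : ℝ) 1, HasDerivAt (fun ρ : ℝ => π / 4 * (ρ ^ 4 *
      (24 + 3 * (ρ ^ 2 * q) + 4 * (ρ ^ 2 * q) ^ 2 - (ρ ^ 2 * q) ^ 3) / (1 - ρ ^ 2 * q) ^ 4))
      (ρ ^ 3 * (π / 2 * (48 + 57 * (ρ ^ 2 * q) + 19 * (ρ ^ 2 * q) ^ 2
        - 5 * (ρ ^ 2 * q) ^ 3 + (ρ ^ 2 * q) ^ 4) / (1 - ρ ^ 2 * q) ^ 5)) ρ := fun ρ hρ => by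
    have hz : HasDerivAt (fun ρ : ℝ => ρ ^ 2 * q) (2 * ρ * q) ρ := by
      simpa using (hasDerivAt_pow 2 ρ).mul_const q
    have hn := (((hz.const_mul 3).const_add 24).add ((hz.pow 2).const_mul 4)).sub (hz.pow 3)
    have h := (((hasDerivAt_pow 4 ρ).mul hn).div ((hz.const_sub 1).pow 4)
      (pow_ne_zero 4 (hne ρ hρ))).const_mul (π / 4)
    refine h.congr_deriv ?_
    have := hne ρ hρ
    simp only [Pi.pow_apply, Pi.mul_apply, Pi.add_apply, Pi.sub_apply]
    push_cast
    field_simp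
    ring
  rw [intervalIntegral.integral_eq_sub_of_hasDerivAt hderiv]
  · simp
    ring
  · refine ContinuousOn.intervalIntegrable ?_
    refine ContinuousOn.mul (by fun_prop) (ContinuousOn.div (by fun_prop) (by fun_prop) ?_)
    exact fun ρ hρ => pow_ne_zero 5 (hne ρ hρ)

/-! ### Closed form of `F` and of its gradient. -/

theorem integral_ball_comp_linearIsometryEquiv (R : E4 ≃ₗᵢ[ℝ] E4) (f : E4 → ℝ) :
    ∫ x in ball (0 : E4) 1, f (R x) = ∫ x in ball (0 : E4) 1, f x := by
  have h := R.measurePreserving.setIntegral_preimage_emb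
    R.toHomeomorph.measurableEmbedding f (ball 0 1)
  rwa [R.preimage_ball, map_zero] at h

/-- A reflection exchanges any two vectors of equal norm. -/
theorem exists_linearIsometryEquiv_apply_eq (p : E4) : ∃ R : E4 ≃ₗᵢ[ℝ] E4, R (‖p‖ • e 0) = p := by
  have h : ‖‖p‖ • e 0‖ = ‖p‖ := by simp [norm_smul, e]
  exact ⟨_, Submodule.reflection_sub h⟩

/-- The rational function giving `F` in terms of `|p|²`. -/
noncomputable def fProfile (q : ℝ) : ℝ :=
  zonalConst * π / 4 * ((24 + 3 * q + 4 * q ^ 2 - q ^ 3) / (1 - q) ^ 4)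

theorem F_eq_fProfile {p : E4} (hp : ‖p‖ < 1) : F p = fProfile (‖p‖ ^ 2) := by
  have h1 : F p = ∫ x in ball (0 : E4) 1, asdDensity ⟪x, p⟫_ℝ (‖x‖ ^ 2 * ‖p‖ ^ 2) :=
    setIntegral_congr_fun measurableSet_ball fun x hx =>
      normSqTwoForm_asdPart_extDeriv_hForm hp hx
  obtain ⟨R, hR⟩ := exists_linearIsometryEquiv_apply_eq p
  set r := ‖p‖ with hr
  have hr0 : 0 ≤ r := norm_nonneg p
  have hinner : ∀ x, ⟪R x, p⟫_ℝ = x 0 * r := fun x => by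
    rw [← hR, R.inner_map_map, inner_smul_right, e, EuclideanSpace.inner_single_right]
    simp [mul_comm]
  have hcont : ContinuousOn (fun z : ℝ × ℝ => asdDensity (z.1 * r) (z.2 * r ^ 2))
      {z | z.1 ^ 2 ≤ z.2 ∧ z.2 ≤ 1} := by
    unfold asdDensity
    refine ContinuousOn.div (by fun_prop) (by fun_prop) fun z hz => pow_ne_zero 6 (ne_of_gt ?_)
    have h2 : z.1 ≤ 1 := by nlinarith [hz.1, hz.2]
    have h3 : z.1 * r < 1 := by nlinarith
    -- From `z.1² ≤ z.2` the denominator is at least `(1 - z.1 r)²`, which is positive.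
    nlinarith [hz.1, mul_le_mul_of_nonneg_right hz.1 (sq_nonneg r), sq_pos_of_pos (sub_pos.2 h3)]
  rw [h1, ← integral_ball_comp_linearIsometryEquiv R]
  simp only [hinner, R.norm_map]
  rw [integral_ball_zonal (Φ := fun a s => asdDensity (a * r) (s * r ^ 2)) hcont]
  have h4 : ∀ ρ ∈ uIcc (0 : ℝ) 1,
      ρ ^ 3 * (∫ θ in (-π)..π, sin θ ^ 2 * asdDensity (ρ * cos θ * r) (ρ ^ 2 * r ^ 2))
      = ρ ^ 3 * (π / 2 * (48 + 57 * (ρ ^ 2 * r ^ 2) + 19 * (ρ ^ 2 * r ^ 2) ^ 2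
        - 5 * (ρ ^ 2 * r ^ 2) ^ 3 + (ρ ^ 2 * r ^ 2) ^ 4) / (1 - ρ ^ 2 * r ^ 2) ^ 5) := by
    intro ρ hρ
    rw [uIcc_of_le zero_le_one] at hρ
    have hu : ρ * r ∈ Ico (0 : ℝ) 1 := ⟨mul_nonneg hρ.1 hr0, by nlinarith [hρ.1, hρ.2]⟩
    have := integral_sin_sq_mul_asdDensity hu
    rw [show (fun θ => sin θ ^ 2 * asdDensity (ρ * cos θ * r) (ρ ^ 2 * r ^ 2))
      = fun θ => sin θ ^ 2 * asdDensity (ρ * r * cos θ) ((ρ * r) ^ 2) by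
        ext θ; rw [mul_right_comm, mul_pow], this]
    ring
  rw [intervalIntegral.integral_congr h4,
    integral_radial ⟨sq_nonneg r, (sq_lt_one_iff₀ hr0).2 hp⟩, fProfile]
  ring

theorem fProfile_pos {q : ℝ} (hq : q ∈ Ico (0 : ℝ) 1) : 0 < fProfile q := by
  have h1 : 0 < 1 - q := by linarith [hq.2]
  have h2 : 0 < 24 + 3 * q + 4 * q ^ 2 - q ^ 3 := by
    nlinarith [hq.1, hq.2, mul_nonneg (sq_nonneg q) h1.le]
  have := zonalConst_pos
  have := pi_pos
  unfold fProfile; positivity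

/-- The derivative of `fProfile`. -/
noncomputable def fProfileDeriv (q : ℝ) : ℝ :=
  zonalConst * π / 4 * ((99 + 17 * q + 5 * q ^ 2 - q ^ 3) / (1 - q) ^ 5)

theorem hasDerivAt_fProfile {q : ℝ} (hq : 1 - q ≠ 0) :
    HasDerivAt fProfile (fProfileDeriv q) q := by
  have hi := hasDerivAt_id q
  have hn := (((hi.const_mul 3).const_add 24).add ((hi.pow 2).const_mul 4)).sub (hi.pow 3)
  have h := (hn.div ((hi.const_sub 1).pow 4) (pow_ne_zero 4 hq)).const_mul (zonalConst * π / 4)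
  refine h.congr_deriv ?_
  rw [fProfileDeriv]
  simp only [Pi.pow_apply, Pi.add_apply, Pi.sub_apply, id]
  push_cast
  field_simp
  ring

theorem hasGradientAt_F {p : E4} (hp : ‖p‖ < 1) :
    HasGradientAt F ((2 * fProfileDeriv (‖p‖ ^ 2)) • p) p := by
  have hq : 1 - ‖p‖ ^ 2 ≠ 0 := by nlinarith [norm_nonneg p]
  have h1 : F =ᶠ[𝓝 p] fun p => fProfile (‖p‖ ^ 2) := by
    filter_upwards [isOpen_ball.mem_nhds (mem_ball_zero_iff.2 hp)] with y hy
    exact F_eq_fProfile (mem_ball_zero_iff.1 hy)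
  have h2 := (hasDerivAt_fProfile hq).comp_hasFDerivAt p
    (hasStrictFDerivAt_norm_sq p).hasFDerivAt
  rw [hasGradientAt_iff_hasFDerivAt]
  refine (h2.congr_of_eventuallyEq h1).congr_fderiv ?_
  ext v
  simp
  ring

/-! ### Asymptotics at the boundary. -/

theorem tendsto_norm_toBoundary : Tendsto (fun p : E4 => ‖p‖) toBoundary (𝓝[<] 1) :=
  tendsto_comap

theorem eventually_toBoundary : ∀ᶠ p : E4 in toBoundary, 0 < ‖p‖ ∧ ‖p‖ < 1 :=
  tendsto_norm_toBoundary.eventually (Ioo_mem_nhdsLT one_pos)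

/-- Here `φ` is the factor left after extracting the power of `bdryDist`; being continuous at `1`,
it may be replaced by its value there. -/
theorem isLittleO_toBoundary_of_tendsto {φ : ℝ → ℝ} {c : ℝ} (hφ : ContinuousAt φ 1)
    (hc : φ 1 = c) (n : ℤ) :
    (fun p : E4 => (φ ‖p‖ - c) * bdryDist p ^ n) =o[toBoundary] fun p => bdryDist p ^ n := by
  have h1 : Tendsto (fun p : E4 => φ ‖p‖ - c) toBoundary (𝓝 0) := by
    have h2 := (hφ.tendsto.mono_left nhdsWithin_le_nhds).comp tendsto_norm_toBoundary
    simpa [hc] using h2.sub_const c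
  have := ((Asymptotics.isLittleO_one_iff ℝ).2 h1).mul_isBigO
    (Asymptotics.isBigO_refl (fun p : E4 => bdryDist p ^ n) toBoundary)
  simpa using this

theorem isLittleO_F : (fun p : E4 => F p - zonalConst * π / 4 * (15 / 8) * bdryDist p ^ (-4 : ℤ))
    =o[toBoundary] (fun p : E4 => bdryDist p ^ (-4 : ℤ)) := by
  -- At `r = 1` the quotient is `30 / 16 = 15/8`.
  have hφ : ContinuousAt (fun r : ℝ => zonalConst * π / 4 *
      ((24 + 3 * r ^ 2 + 4 * (r ^ 2) ^ 2 - (r ^ 2) ^ 3) / (1 + r) ^ 4)) 1 :=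
    ContinuousAt.mul continuousAt_const
      (ContinuousAt.div (by fun_prop) (by fun_prop) (by norm_num))
  refine (isLittleO_toBoundary_of_tendsto hφ (c := zonalConst * π / 4 * (15 / 8))
    (by norm_num) (-4)).congr' ?_ EventuallyEq.rfl
  filter_upwards [eventually_toBoundary] with p hp
  have h1 : 1 - ‖p‖ ≠ 0 := by linarith [hp.2]
  have h2 : 1 + ‖p‖ ≠ 0 := by linarith [hp.1]
  rw [F_eq_fProfile hp.2, fProfile, bdryDist, sub_mul,
    show 1 - ‖p‖ ^ 2 = (1 - ‖p‖) * (1 + ‖p‖) by ring, mul_pow, zpow_neg]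
  congr 1
  norm_cast
  field_simp

theorem isLittleO_gradient_F :
    (fun p : E4 => gradient F p
        - (zonalConst * π / 4 * (15 / 2) * bdryDist p ^ (-5 : ℤ)) • (‖p‖⁻¹ • p))
      =o[toBoundary] (fun p : E4 => bdryDist p ^ (-5 : ℤ)) := by
  -- The factor `2r` comes from the chain rule for `|p|²`, with `p = r · p/|p|`; at `r = 1` the
  -- quotient is `240 / 32 = 15/2`.
  have hφ : ContinuousAt (fun r : ℝ => zonalConst * π / 4 *
      (2 * r * (99 + 17 * r ^ 2 + 5 * (r ^ 2) ^ 2 - (r ^ 2) ^ 3) / (1 + r) ^ 5)) 1 :=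
    ContinuousAt.mul continuousAt_const
      (ContinuousAt.div (by fun_prop) (by fun_prop) (by norm_num))
  have hscalar := isLittleO_toBoundary_of_tendsto hφ (c := zonalConst * π / 4 * (15 / 2))
    (by norm_num) (-5)
  have hunit : (fun p : E4 => ‖p‖⁻¹ • p) =O[toBoundary] fun _ => (1 : ℝ) := by
    refine Asymptotics.IsBigO.of_bound 1 (Eventually.of_forall fun p => ?_)
    rcases eq_or_ne p 0 with rfl | hp
    · simp
    · rw [norm_smul, norm_inv, norm_norm, inv_mul_cancel₀ (norm_ne_zero_iff.2 hp)]
      simp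
  refine (hscalar.smul_isBigO hunit).congr' ?_ (by simp)
  filter_upwards [eventually_toBoundary] with p hp
  have h0 : ‖p‖ ≠ 0 := hp.1.ne'
  have h1 : 1 - ‖p‖ ≠ 0 := by linarith [hp.2]
  have h2 : 1 + ‖p‖ ≠ 0 := by linarith [hp.1]
  rw [(hasGradientAt_F hp.2).gradient, sub_mul, sub_smul]
  congr 1
  rw [smul_smul]
  congr 1
  rw [fProfileDeriv, bdryDist, show 1 - ‖p‖ ^ 2 = (1 - ‖p‖) * (1 + ‖p‖) by ring, mul_pow, zpow_neg]
  norm_cast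
  field_simp

end YMDirichlet

open YMDirichlet in
theorem lemma2p1 :
    -- the Dirichlet problem defining `h_p` is well posed, with solution `hForm p`
    (∀ p ∈ ball (0 : E4) 1, IsDirichletSolution p (hForm p) ∧
      ∀ u, IsDirichletSolution p u → EqOn u (hForm p) (closedBall 0 1)) ∧
    -- positivity
    (∀ p ∈ ball (0 : E4) 1, 0 < F p) ∧
    -- asymptotics of `F`
    (∃ C₁ : ℝ, 0 < C₁ ∧
      (fun p : E4 => F p - C₁ * bdryDist p ^ (-4 : ℤ))
        =o[toBoundary] (fun p : E4 => bdryDist p ^ (-4 : ℤ))) ∧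
    -- differentiability of `F` and asymptotics of its gradient
    (∀ p ∈ ball (0 : E4) 1, DifferentiableAt ℝ F p) ∧
    (∃ C₂ : ℝ, 0 < C₂ ∧
      (fun p : E4 => gradient F p - (C₂ * bdryDist p ^ (-5 : ℤ)) • (‖p‖⁻¹ • p))
        =o[toBoundary] (fun p : E4 => bdryDist p ^ (-5 : ℤ))) := by
  have hK : 0 < zonalConst * Real.pi / 4 := by
    have := zonalConst_pos
    have := Real.pi_pos
    positivity
  refine ⟨fun p hp => ?_, fun p hp => ?_, ⟨_, by positivity, isLittleO_F⟩, fun p hp => ?_,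
    ⟨_, by positivity, isLittleO_gradient_F⟩⟩ <;> rw [mem_ball_zero_iff] at hp
  · have h := isDirichletSolution_hForm hp
    exact ⟨h, fun u hu => hu.eqOn h⟩
  · rw [F_eq_fProfile hp]
    exact fProfile_pos ⟨sq_nonneg _, (sq_lt_one_iff₀ (norm_nonneg p)).2 hp⟩
  · exact (hasGradientAt_F hp).differentiableAt
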